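/- A (non-trivial) planar doodle diagram is a finite connected 4-valent graph $D$ with at least one vertex (crossing), loops and multiple edges allowed, embedded in the sphere $S^2$. It defines a cell subdivision of $S^2$ with the crossings as 0-cells, the edges as 1-cells and the components of $S^2\setminus D$, called the regions, as 2-cells; it is recorded by its finite set of darts (oriented edges), the reversal of darts and the cyclic order of the darts around each crossing, the sphere being characterised by Euler characteristic $2$. The diagram is minimal if no region is a monogon or a bigon, that is, no region has a boundary curve of exactly one or exactly two edges. A graph is $k$-connected if it has more than $k$ vertices and is not disconnected by the removal of fewer than $k$ vertices. A diagram is called prime if its graph is 3-connected. **Theorem.** Let $D$ be a minimal planar doodle diagram whose graph is 2-connected. Then $D$ is prime if and only if for every two distinct regions $R\ne S$ of $D$ the intersection $\overline R\cap\overline S$ of their closures is empty, or consists of exactly one crossing, or is exactly one closed edge (an edge together with its end points). -/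

import Mathlib

/-- A graph is `k`-connected if it has more than `k` vertices and is not disconnected by the
removal of fewer than `k` vertices. -/
def IsKConnected {V : Type*} (G : SimpleGraph V) (k : ℕ) : Prop :=
  k < Nat.card V ∧ ∀ X : Finset V, X.card < k → (G.induce {v | v ∉ X}).Connected

/-- A cell subdivision of a closed oriented surface, recorded by its finite set `D` of darts
(oriented edges): `rev` reverses a dart, and `next` sends a dart to the next one, in
counterclockwise order, among the darts issuing from the same vertex. -/
structure CellMap (D : Type*) where
  next : Equiv.Perm D
  rev : Equiv.Perm D
  rev_rev : ∀ d, rev (rev d) = d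
  rev_ne : ∀ d, rev d ≠ d

namespace CellMap

variable {D : Type*} (M : CellMap D)

/-- The dart that follows `d` on the boundary of the region to the left of `d`: go to the end
of `d` and turn as sharply to the left as possible. -/
def walk : Equiv.Perm D := M.rev.trans M.next.symm

/-- Vertices (crossings): the cycles of `next`. -/
def Vertex : Type _ := Quotient (Equiv.Perm.SameCycle.setoid M.next)

/-- Edges: the two-element cycles of `rev`. -/
def Edge : Type _ := Quotient (Equiv.Perm.SameCycle.setoid M.rev)

/-- Regions (2-cells): the cycles of `walk`, i.e. the boundary curves of the 2-cells. -/
def Region : Type _ := Quotient (Equiv.Perm.SameCycle.setoid M.walk)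

/-- The vertex from which a dart issues. -/
def origin (d : D) : M.Vertex := Quotient.mk _ d

/-- The edge that carries a dart. -/
def edgeOf (d : D) : M.Edge := Quotient.mk _ d

/-- The region to the left of a dart. -/
def leftRegion (d : D) : M.Region := Quotient.mk _ d

/-- Adjacency of vertices in the 1-skeleton. Loops and multiple edges may occur in the
1-skeleton; they do not affect its connectivity. -/
def graph : SimpleGraph M.Vertex where
  Adj u v := u ≠ v ∧ ∃ d, M.origin d = u ∧ M.origin (M.rev d) = v
  symm := ⟨by
    rintro u v ⟨h, d, rfl, rfl⟩
    exact ⟨h.symm, M.rev d, rfl, by rw [M.rev_rev]⟩⟩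
  loopless := ⟨fun _ h => h.1 rfl⟩

/-- The number of edge-ends at a vertex. -/
noncomputable def valency (v : M.Vertex) : ℕ := {d | M.origin d = v}.ncard

/-- The number of edges in the boundary curve of a region: the region is an `i`-gon for this
number `i`. -/
noncomputable def sides (R : M.Region) : ℕ := {d | M.leftRegion d = R}.ncard

/-- The Euler characteristic of the underlying surface. -/
noncomputable def eulerChar : ℤ :=
  (Nat.card M.Vertex : ℤ) - Nat.card M.Edge + Nat.card M.Region

/-- The (open) cells of the subdivision. -/
inductive Cell
  | vertex (v : M.Vertex)
  | edge (e : M.Edge)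
  | region (R : M.Region)

/-- The closure of a vertex, as the set of the open cells that it consists of. -/
def closedVertex (v : M.Vertex) : Set M.Cell := {Cell.vertex v}

/-- The closure of an edge: the edge and its end points. -/
def closedEdge (e : M.Edge) : Set M.Cell :=
  {Cell.edge e} ∪ {c | ∃ d, M.edgeOf d = e ∧ c = Cell.vertex (M.origin d)}

/-- The closure of a region: the region and the closed edges on its boundary curve. -/
def closedRegion (R : M.Region) : Set M.Cell :=
  {Cell.region R} ∪ {c | ∃ d, M.leftRegion d = R ∧ c ∈ M.closedEdge (M.edgeOf d)}

end CellMap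

/-- A (non-trivial) planar doodle diagram: a connected 4-valent graph on the sphere, given by
the cell subdivision of the sphere that it defines. The sphere is the closed connected
oriented surface of Euler characteristic 2. -/
structure PlanarDoodle (D : Type*) extends CellMap D where
  four_valent : ∀ v, toCellMap.valency v = 4
  connected : toCellMap.graph.Connected
  spherical : toCellMap.eulerChar = 2

namespace PlanarDoodle

variable {D : Type*} (M : PlanarDoodle D)

/-- A diagram is minimal if no region is a monogon or a bigon. -/
def IsMinimal : Prop := ∀ R : M.Region, M.sides R ≠ 1 ∧ M.sides R ≠ 2

/-- A diagram is 2-connected if its graph is. -/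
def IsTwoConnected : Prop := IsKConnected M.graph 2

/-- A diagram is prime if its graph is 3-connected. -/
def IsPrime : Prop := IsKConnected M.graph 3

end PlanarDoodle

/-!
A set `T` of corners that meets every vertex and every region an even number of times describes
closed curves through vertices and regions. On the sphere such curves separate the edges into two
sides: a dimension count modulo 2 with Euler's formula shows that `T` is the boundary of a set of
edges.

If the diagram is prime and the closures of `R` and `S` share two vertices, the closed curve that
runs through `R` and `S` and these two vertices has on one of its sides only edges between the two
vertices; as there are no bigons, this is a single edge, and it lies between `R` and `S`.

Conversely, if two vertices `u` and `v` separate the diagram, consider the edges on one side. The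
regions in which they meet other edges at `u` are also incident with `v`, so by hypothesis any two
of them share the edge `uv`. Hence at most one of the four edge-ends at `u` is missing from that
side, which cannot hold for two different sides at once.
-/

section Cycles

open Equiv.Perm Function

variable {α : Type*} {σ : Equiv.Perm α} {x y : α}

theorem sameCycle_iff_of_apply_apply_eq_self (hx : σ (σ x) = x) :
    σ.SameCycle x y ↔ y = x ∨ y = σ x := by
  constructor
  · rintro ⟨i, rfl⟩
    exact zpow_apply_eq_of_apply_apply_eq_self hx i
  · rintro (rfl | rfl)
    · exact .rfl
    · exact sameCycle_apply_right.2 .rfl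

theorem eq_of_sameCycle {β : Type*} {f : α → β} (hxy : σ.SameCycle x y)
    (hf : ∀ z, σ.SameCycle x z → f (σ z) = f z) : f y = f x := by
  obtain ⟨i, rfl⟩ := hxy
  induction i using Int.induction_on with
  | zero => rfl
  | succ i ih => rw [add_comm, zpow_add, zpow_one, mul_apply, hf _ ⟨i, rfl⟩, ih]
  | pred i ih =>
    rw [← ih, ← hf _ ⟨-i - 1, rfl⟩, ← mul_apply, ← zpow_one_add, add_sub_cancel]

open Classical in
theorem sum_sameCycle [Fintype α] {β : Type*} [AddCommMonoid β] (σ : Equiv.Perm α) (x : α)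
    (f : α → β) : ∑ y with σ.SameCycle x y, f y = ∑ i ∈ Finset.range (minimalPeriod σ x),
      f (σ^[i] x) := by
  have hpos : 0 < minimalPeriod σ x :=
    minimalPeriod_pos_of_mem_periodicPts (σ.injective.mem_periodicPts x)
  symm
  refine Finset.sum_nbij (fun i => σ^[i] x) (fun i _ => ?_) (fun i hi j hj => ?_)
    (fun y hy => ?_) fun _ _ => rfl
  · rw [Finset.mem_filter_univ, iterate_eq_pow]
    exact sameCycle_pow_right.2 .rfl
  · exact iterate_injOn_Iio_minimalPeriod (by simpa using hi) (by simpa using hj)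
  · obtain ⟨i, rfl⟩ := (Finset.mem_filter_univ y).1 hy |>.exists_nat_pow_eq
    refine ⟨i % minimalPeriod σ x, by simpa using Nat.mod_lt i hpos, ?_⟩
    simp only [iterate_mod_minimalPeriod_eq, iterate_eq_pow]

theorem ncard_sameCycle [Finite α] (σ : Equiv.Perm α) (x : α) :
    {y | σ.SameCycle x y}.ncard = minimalPeriod σ x := by
  classical
  have := Fintype.ofFinite α
  have h := sum_sameCycle σ x fun _ => 1
  simp only [Finset.sum_const, Finset.card_range, smul_eq_mul, mul_one] at h
  rw [← h, ← Set.ncard_coe_finset, Finset.coe_filter_univ]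

end Cycles

theorem sum_ncard_fiber {α β : Type*} [Finite α] [Fintype β] (p : α → β) :
    ∑ b, {a | p a = b}.ncard = Nat.card α := by
  rw [← Nat.card_congr (Equiv.sigmaFiberEquiv p), Nat.card_sigma]
  rfl

theorem finrank_le_one_of_forall_eq {K ι : Type*} [Field K] {W : Submodule K (ι → K)}
    (hW : ∀ g ∈ W, ∀ i j, g i = g j) : Module.finrank K W ≤ 1 := by
  have hle : W ≤ Submodule.span K {1} := fun g hg => by
    rw [Submodule.mem_span_singleton]
    obtain hι | ⟨⟨i⟩⟩ := isEmpty_or_nonempty ι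
    · exact ⟨0, Subsingleton.elim _ _⟩
    · exact ⟨g i, funext fun j => by simp [hW g hg i j]⟩
  exact (Submodule.finrank_mono hle).trans ((finrank_span_le_card {1}).trans (by simp))

namespace CellMap

open Equiv.Perm Function

variable {D : Type*} (M : CellMap D)

theorem origin_eq_iff {d d' : D} : M.origin d = M.origin d' ↔ M.next.SameCycle d d' :=
  Quotient.eq (r := SameCycle.setoid M.next)

theorem leftRegion_eq_iff {d d' : D} : M.leftRegion d = M.leftRegion d' ↔ M.walk.SameCycle d d' :=
  Quotient.eq (r := SameCycle.setoid M.walk)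

theorem edgeOf_eq_iff {d d' : D} : M.edgeOf d = M.edgeOf d' ↔ d' = d ∨ d' = M.rev d :=
  (Quotient.eq (r := SameCycle.setoid M.rev)).trans
    (sameCycle_iff_of_apply_apply_eq_self (M.rev_rev d))

theorem origin_surjective : Surjective M.origin := Quotient.mk_surjective

theorem edgeOf_surjective : Surjective M.edgeOf := Quotient.mk_surjective

theorem leftRegion_surjective : Surjective M.leftRegion := Quotient.mk_surjective

instance [Finite D] : Finite M.Vertex := .of_surjective _ M.origin_surjective

instance [Finite D] : Finite M.Edge := .of_surjective _ M.edgeOf_surjective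

instance [Finite D] : Finite M.Region := .of_surjective _ M.leftRegion_surjective

@[simp]
theorem origin_next (d : D) : M.origin (M.next d) = M.origin d :=
  M.origin_eq_iff.2 (sameCycle_apply_left.2 .rfl)

@[simp]
theorem origin_next_symm (d : D) : M.origin (M.next.symm d) = M.origin d :=
  M.origin_eq_iff.2 (sameCycle_symm_apply_left.2 .rfl)

@[simp]
theorem edgeOf_rev (d : D) : M.edgeOf (M.rev d) = M.edgeOf d :=
  M.edgeOf_eq_iff.2 (Or.inr (M.rev_rev d).symm)

@[simp]
theorem leftRegion_walk (d : D) : M.leftRegion (M.walk d) = M.leftRegion d :=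
  M.leftRegion_eq_iff.2 (sameCycle_apply_left.2 .rfl)

theorem walk_apply (d : D) : M.walk d = M.next.symm (M.rev d) := rfl

@[simp]
theorem walk_rev (d : D) : M.walk (M.rev d) = M.next.symm d := by rw [walk_apply, M.rev_rev]

@[simp]
theorem next_walk (d : D) : M.next (M.walk d) = M.rev d := M.next.apply_symm_apply _

@[simp]
theorem origin_walk (d : D) : M.origin (M.walk d) = M.origin (M.rev d) := M.origin_next_symm _

@[simp]
theorem leftRegion_next_symm (d : D) : M.leftRegion (M.next.symm d) = M.leftRegion (M.rev d) := by
  rw [← M.walk_rev, M.leftRegion_walk]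

@[simp]
theorem leftRegion_rev_next (d : D) : M.leftRegion (M.rev (M.next d)) = M.leftRegion d := by
  rw [← M.leftRegion_next_symm, Equiv.symm_apply_apply]

theorem ncard_setOf_origin_eq [Finite D] (d : D) :
    {d' | M.origin d' = M.origin d}.ncard = minimalPeriod M.next d := by
  simp only [← ncard_sameCycle, ← M.origin_eq_iff, eq_comm]

theorem ncard_setOf_leftRegion_eq [Finite D] (d : D) :
    {d' | M.leftRegion d' = M.leftRegion d}.ncard = minimalPeriod M.walk d := by
  simp only [← ncard_sameCycle, ← M.leftRegion_eq_iff, eq_comm]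

theorem two_mul_card_edge [Finite D] : 2 * Nat.card M.Edge = Nat.card D := by
  have := Fintype.ofFinite M.Edge
  have hfiber : ∀ e, {d | M.edgeOf d = e}.ncard = 2 := by
    rw [M.edgeOf_surjective.forall]
    intro d
    simp only [eq_comm (b := M.edgeOf d), M.edgeOf_eq_iff]
    exact Set.ncard_pair (M.rev_ne d).symm
  rw [← sum_ncard_fiber M.edgeOf, Finset.sum_congr rfl fun e _ => hfiber e, Finset.sum_const,
    Finset.card_univ, smul_eq_mul, mul_comm, Nat.card_eq_fintype_card]

theorem eq_of_preconnected_induce {β : Type*} {s : Set M.Vertex} {f : D → β}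
    (hs : (M.graph.induce s).Preconnected) (hrev : ∀ d, f (M.rev d) = f d)
    (hnext : ∀ d, M.origin d ∈ s → f (M.next d) = f d) {d d' : D} (hd : M.origin d ∈ s)
    (hd' : M.origin d' ∈ s) : f d = f d' := by
  have hvertex : ∀ d d', M.origin d ∈ s → M.origin d = M.origin d' → f d = f d' :=
    fun d d' hd h => (eq_of_sameCycle (M.origin_eq_iff.1 h) fun z hz =>
      hnext z (M.origin_eq_iff.2 hz ▸ hd)).symm
  suffices H : ∀ a b : s, (M.graph.induce s).Reachable a b →
      ∀ d d', M.origin d = a → M.origin d' = b → f d = f d' from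
    H ⟨_, hd⟩ ⟨_, hd'⟩ (hs _ _) d d' rfl rfl
  rintro a b ⟨w⟩
  induction w with
  | nil => exact fun d d' h h' => hvertex d d' (h ▸ Subtype.property _) (h.trans h'.symm)
  | cons hadj _ ih =>
    intro d d' h h'
    obtain ⟨-, e, he, he'⟩ := hadj
    calc f d = f e := hvertex d e (h ▸ Subtype.property _) (h.trans he.symm)
      _ = f (M.rev e) := (hrev e).symm
      _ = f d' := ih _ _ he' h'

theorem eq_of_connected {β : Type*} {f : D → β} (hM : M.graph.Connected)
    (hrev : ∀ d, f (M.rev d) = f d) (hnext : ∀ d, f (M.next d) = f d) (d d' : D) : f d = f d' :=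
  M.eq_of_preconnected_induce (s := Set.univ)
    (M.graph.induceUnivIso.connected_iff.2 hM).preconnected hrev (fun d _ => hnext d)
    trivial trivial

/-- A set of edges, encoded as the set of all darts that these edges carry. -/
def IsEdgeSet (S : Set D) : Prop := ∀ d, M.rev d ∈ S ↔ d ∈ S

/-- The corners at which a closed curve running alongside the edges in `S` crosses over: the
corner of a dart `d` is the sector between `d` and `next d`, which belongs to the region to the
left of `d`, and it is in the boundary of `S` if exactly one of its two sides is in `S`. -/
def cornerBoundary (S : Set D) : Set D := {d | ¬(M.next d ∈ S ↔ d ∈ S)}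

variable {M}

theorem mem_cornerBoundary {S : Set D} {d : D} :
    d ∈ M.cornerBoundary S ↔ ¬(M.next d ∈ S ↔ d ∈ S) := Iff.rfl

theorem IsEdgeSet.compl {S : Set D} (hS : M.IsEdgeSet S) : M.IsEdgeSet Sᶜ :=
  fun d => not_congr (hS d)

theorem cornerBoundary_compl (S : Set D) : M.cornerBoundary Sᶜ = M.cornerBoundary S :=
  Set.ext fun _ => not_congr not_iff_not

theorem IsEdgeSet.cornerBoundary_nonempty {S : Set D} (hS : M.IsEdgeSet S)
    (hM : M.graph.Connected) {d d' : D} (hd : d ∈ S) (hd' : d' ∉ S) :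
    (M.cornerBoundary S).Nonempty := by
  by_contra! hempty
  have hnext : ∀ d, (M.next d ∈ S) = (d ∈ S) := fun d => propext <| not_not.1 fun h =>
    Set.eq_empty_iff_forall_notMem.1 hempty d h
  have heq : (d ∈ S) = (d' ∈ S) := M.eq_of_connected hM (fun d => propext (hS d)) hnext d d'
  exact hd' (heq ▸ hd)

theorem IsEdgeSet.subset_or_disjoint {S : Set D} (hS : M.IsEdgeSet S) {X : Set M.Vertex}
    (hX : (M.graph.induce Xᶜ).Preconnected) (hSX : ∀ d ∈ M.cornerBoundary S, M.origin d ∈ X) :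
    (∀ d ∈ S, M.origin d ∈ X) ∨ ∀ d ∈ Sᶜ, M.origin d ∈ X := by
  by_contra! ⟨⟨d, hd, hdX⟩, d', hd', hd'X⟩
  have heq : (d ∈ S) = (d' ∈ S) := M.eq_of_preconnected_induce hX (fun d => propext (hS d))
    (fun d hdX => propext (not_not.1 fun h => hdX (hSX d h))) hdX hd'X
  exact hd' (heq ▸ hd)

theorem indicator_cornerBoundary (S : Set D) (d : D) :
    (M.cornerBoundary S).indicator (1 : D → ZMod 2) d =
      S.indicator 1 d + S.indicator 1 (M.next d) := by
  by_cases h : d ∈ S <;> by_cases h' : M.next d ∈ S <;>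
    simp [mem_cornerBoundary, h, h', CharTwo.add_self_eq_zero]

section Parity

variable [Fintype D]

open Classical in
theorem sum_origin_add_next (f : D → ZMod 2) (v : M.Vertex) :
    ∑ d with M.origin d = v, (f d + f (M.next d)) = 0 := by
  have hnext : ∑ d with M.origin d = v, f (M.next d) = ∑ d with M.origin d = v, f d := by
    simp only [Finset.sum_filter]
    rw [← Equiv.sum_comp M.next fun d => if M.origin d = v then f d else 0]
    simp only [origin_next]
  rw [Finset.sum_add_distrib, hnext, CharTwo.add_self_eq_zero]

open Classical in
theorem sum_leftRegion_add_next {f : D → ZMod 2} (hf : ∀ d, f (M.rev d) = f d) (R : M.Region) :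
    ∑ d with M.leftRegion d = R, (f d + f (M.next d)) = 0 := by
  have hwalk : ∑ d with M.leftRegion d = R, f (M.next d) = ∑ d with M.leftRegion d = R, f d := by
    simp only [Finset.sum_filter]
    rw [← Equiv.sum_comp M.walk]
    simp only [leftRegion_walk, next_walk, hf]
  rw [Finset.sum_add_distrib, hwalk, CharTwo.add_self_eq_zero]

end Parity

theorem exists_ne_of_sum_indicator_eq_zero {α : Type*} {s : Finset α} {T : Set α} {y : α}
    (hs : ∑ x ∈ s, T.indicator (1 : α → ZMod 2) x = 0) (hys : y ∈ s) (hy : y ∈ T) :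
    ∃ t ∈ s, t ∈ T ∧ t ≠ y := by
  by_contra! h
  rw [Finset.sum_eq_single_of_mem y hys fun t ht hty =>
    Set.indicator_of_notMem (fun htT => hty (h t ht htT)) _, Set.indicator_of_mem hy] at hs
  exact one_ne_zero hs

theorem exists_mem_cornerBoundary_origin_eq [Finite D] {S : Set D} {y : D}
    (hy : y ∈ M.cornerBoundary S) :
    ∃ t ∈ M.cornerBoundary S, t ≠ y ∧ M.origin t = M.origin y := by
  classical
  have := Fintype.ofFinite D
  obtain ⟨t, ht, htS, hty⟩ := exists_ne_of_sum_indicator_eq_zero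
    (s := {d | M.origin d = M.origin y}) (by
      simpa only [indicator_cornerBoundary] using sum_origin_add_next (S.indicator 1) _)
    (by simp) hy
  exact ⟨t, htS, hty, by simpa using ht⟩

theorem IsEdgeSet.exists_mem_cornerBoundary_leftRegion_eq [Finite D] {S : Set D}
    (hS : M.IsEdgeSet S) {y : D} (hy : y ∈ M.cornerBoundary S) :
    ∃ t ∈ M.cornerBoundary S, t ≠ y ∧ M.leftRegion t = M.leftRegion y := by
  classical
  have := Fintype.ofFinite D
  have hrev : ∀ d, S.indicator (1 : D → ZMod 2) (M.rev d) = S.indicator 1 d := fun d => by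
    simp [Set.indicator_apply, hS d]
  obtain ⟨t, ht, htS, hty⟩ := exists_ne_of_sum_indicator_eq_zero
    (s := {d | M.leftRegion d = M.leftRegion y}) (by
      simpa only [indicator_cornerBoundary] using sum_leftRegion_add_next hrev _)
    (by simp) hy
  exact ⟨t, htS, hty, by simpa using ht⟩

end CellMap

/-! ### A Jordan curve theorem -/

namespace CellMap

variable {D : Type*} {M : CellMap D}

open Matrix Module

section Jordan

variable (M)

/-- The difference map along `next`, from functions on the edges to functions on the corners: it
sends the indicator of a set of edges to the indicator of its corner boundary. -/
noncomputable def edgeCoboundary : (M.Edge → ZMod 2) →ₗ[ZMod 2] D → ZMod 2 :=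
  .funLeft _ _ M.edgeOf + .funLeft _ _ (M.edgeOf ∘ M.next)

@[simp]
theorem edgeCoboundary_apply (g : M.Edge → ZMod 2) (d : D) :
    M.edgeCoboundary g d = g (M.edgeOf d) + g (M.edgeOf (M.next d)) := rfl

open Classical in
/-- The incidence matrix of the corners with the vertices and the regions. -/
noncomputable def cornerIncidence : Matrix D (M.Vertex ⊕ M.Region) (ZMod 2) :=
  .of fun d => Sum.elim (fun v => if M.origin d = v then 1 else 0)
    fun R => if M.leftRegion d = R then 1 else 0

open Classical in
theorem cornerIncidence_mulVec [Fintype M.Vertex] [Fintype M.Region]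
    (g : M.Vertex ⊕ M.Region → ZMod 2) (d : D) :
    (M.cornerIncidence *ᵥ g) d = g (.inl (M.origin d)) + g (.inr (M.leftRegion d)) := by
  simp [cornerIncidence, mulVec, dotProduct]

open Classical in
theorem transpose_cornerIncidence_mulVec_inl [Fintype D] (f : D → ZMod 2) (v : M.Vertex) :
    (M.cornerIncidenceᵀ *ᵥ f) (.inl v) = ∑ d with M.origin d = v, f d := by
  simp [cornerIncidence, mulVec, dotProduct, Finset.sum_filter]

open Classical in
theorem transpose_cornerIncidence_mulVec_inr [Fintype D] (f : D → ZMod 2) (R : M.Region) :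
    (M.cornerIncidenceᵀ *ᵥ f) (.inr R) = ∑ d with M.leftRegion d = R, f d := by
  simp [cornerIncidence, mulVec, dotProduct, Finset.sum_filter]

theorem card_edge_le_finrank_range_edgeCoboundary [Finite D] (hM : M.graph.Connected) :
    Nat.card M.Edge ≤ finrank (ZMod 2) M.edgeCoboundary.range + 1 := by
  have := Fintype.ofFinite M.Edge
  have hker : finrank (ZMod 2) M.edgeCoboundary.ker ≤ 1 := by
    refine finrank_le_one_of_forall_eq fun g hg => ?_
    have hnext (d : D) : g (M.edgeOf (M.next d)) = g (M.edgeOf d) :=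
      (CharTwo.add_eq_zero.1 (congrFun (LinearMap.mem_ker.1 hg) d)).symm
    exact M.edgeOf_surjective.forall₂.2 <| M.eq_of_connected hM
      (fun d => congrArg g (M.edgeOf_rev d)) hnext
  have hrank := M.edgeCoboundary.finrank_range_add_finrank_ker
  rw [finrank_fintype_fun_eq_card, ← Nat.card_eq_fintype_card] at hrank
  omega

theorem card_vertex_add_card_region_le_rank_cornerIncidence [Fintype D]
    (hM : M.graph.Connected) :
    Nat.card M.Vertex + Nat.card M.Region ≤ M.cornerIncidenceᵀ.rank + 1 := by
  classical
  have := Fintype.ofFinite M.Vertex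
  have := Fintype.ofFinite M.Region
  have hker : finrank (ZMod 2) M.cornerIncidence.mulVecLin.ker ≤ 1 := by
    refine finrank_le_one_of_forall_eq fun g hg => ?_
    have hcorner (d : D) : g (.inl (M.origin d)) = g (.inr (M.leftRegion d)) :=
      CharTwo.add_eq_zero.1 <| by
        simpa [cornerIncidence_mulVec] using congrFun (LinearMap.mem_ker.1 hg) d
    have hnext (d : D) : g (.inl (M.origin (M.next d))) = g (.inl (M.origin d)) := by
      rw [origin_next]
    have hrev (d : D) : g (.inl (M.origin (M.rev d))) = g (.inl (M.origin d)) := by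
      rw [← origin_walk, hcorner, leftRegion_walk, hcorner]
    have hvertex (d d' : D) : g (.inl (M.origin d)) = g (.inl (M.origin d')) :=
      M.eq_of_connected (f := fun d => g (.inl (M.origin d))) hM hrev hnext d d'
    have hval : ∀ a, ∃ d, g a = g (.inl (M.origin d)) := by
      rw [Sum.forall, M.origin_surjective.forall, M.leftRegion_surjective.forall]
      exact ⟨fun d => ⟨d, rfl⟩, fun d => ⟨d, (hcorner d).symm⟩⟩
    intro a b
    obtain ⟨d, hd⟩ := hval a
    obtain ⟨d', hd'⟩ := hval b
    rw [hd, hd', hvertex]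
  have hrank := M.cornerIncidence.mulVecLin.finrank_range_add_finrank_ker
  rw [finrank_fintype_fun_eq_card, Fintype.card_sum, ← Nat.card_eq_fintype_card,
    ← Nat.card_eq_fintype_card] at hrank
  rw [rank_transpose, rank]
  omega

theorem range_edgeCoboundary_eq_ker [Fintype D] (hM : M.graph.Connected)
    (hsphere : M.eulerChar = 2) :
    M.edgeCoboundary.range = M.cornerIncidenceᵀ.mulVecLin.ker := by
  classical
  have := Fintype.ofFinite M.Vertex
  have := Fintype.ofFinite M.Region
  refine Submodule.eq_of_le_of_finrank_le ?_ ?_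
  · rintro _ ⟨g, rfl⟩
    rw [LinearMap.mem_ker, mulVecLin_apply]
    ext (v | R)
    · rw [transpose_cornerIncidence_mulVec_inl]
      exact sum_origin_add_next (g ∘ M.edgeOf) v
    · rw [transpose_cornerIncidence_mulVec_inr]
      exact sum_leftRegion_add_next (f := g ∘ M.edgeOf) (fun d => congrArg g (M.edgeOf_rev d)) R
  · have hrank := M.cornerIncidenceᵀ.mulVecLin.finrank_range_add_finrank_ker
    rw [finrank_fintype_fun_eq_card, ← Nat.card_eq_fintype_card, ← M.two_mul_card_edge] at hrank
    have hδ := M.card_edge_le_finrank_range_edgeCoboundary hM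
    have hN := M.card_vertex_add_card_region_le_rank_cornerIncidence hM
    rw [rank] at hN
    rw [eulerChar] at hsphere
    omega

variable {M}

open Classical in
/-- A form of the Jordan curve theorem: a closed curve through the regions and vertices that
passes through the corners in `T` separates the edges into two sides. -/
theorem exists_isEdgeSet_cornerBoundary_eq [Finite D] (hM : M.graph.Connected)
    (hsphere : M.eulerChar = 2) {T : Finset D}
    (hvertex : ∀ v, Even ({d ∈ T | M.origin d = v}.card))
    (hregion : ∀ R, Even ({d ∈ T | M.leftRegion d = R}.card)) :
    ∃ S, M.IsEdgeSet S ∧ M.cornerBoundary S = T := by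
  have := Fintype.ofFinite D
  have hsum {p : D → Prop} (hp : Even {d ∈ T | p d}.card) :
      ∑ d with p d, (T : Set D).indicator (1 : D → ZMod 2) d = 0 := by
    rw [← (ZMod.natCast_eq_zero_iff_even).2 hp]
    simp only [Set.indicator_apply, SetLike.mem_coe, Pi.one_apply, Finset.sum_boole]
    rw [Finset.filter_comm, Finset.filter_univ_mem]
  have hker : (T : Set D).indicator 1 ∈ M.cornerIncidenceᵀ.mulVecLin.ker := by
    rw [LinearMap.mem_ker, mulVecLin_apply]
    ext (v | R)
    · rw [transpose_cornerIncidence_mulVec_inl]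
      exact hsum (hvertex v)
    · rw [transpose_cornerIncidence_mulVec_inr]
      exact hsum (hregion R)
  rw [← M.range_edgeCoboundary_eq_ker hM hsphere] at hker
  obtain ⟨g, hg⟩ := hker
  refine ⟨{d | g (M.edgeOf d) = 1}, fun d => by simp, Set.ext fun d => ?_⟩
  have hxor : ∀ a b : ZMod 2, ¬(b = 1 ↔ a = 1) ↔ a + b = 1 := by decide
  exact (hxor _ _).trans (by simp [← edgeCoboundary_apply, hg, Set.indicator_apply])

end Jordan

end CellMap

/-! ### Corners of a planar doodle -/

open Classical in
theorem even_card_filter_insert_insert {α : Type*} {x y : α} {s : Finset α} (hxy : x ≠ y)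
    (hx : x ∉ s) (hy : y ∉ s) {p : α → Prop} (hp : p x ↔ p y) (hs : Even {z ∈ s | p z}.card) :
    Even {z ∈ insert x (insert y s) | p z}.card := by
  by_cases h : p y
  · simpa [Finset.filter_insert, hp, h, hxy, hx, hy, add_assoc] using hs.add even_two
  · simpa [Finset.filter_insert, hp, h] using hs

open Classical in
theorem even_card_filter_pair {α : Type*} {x y : α} (hxy : x ≠ y) {p : α → Prop}
    (hp : p x ↔ p y) : Even {z ∈ ({x, y} : Finset α) | p z}.card :=
  even_card_filter_insert_insert (s := ∅) hxy (by simp) (by simp) hp (by simp)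

namespace PlanarDoodle

open Function

variable {D : Type*} [Finite D] (M : PlanarDoodle D)

theorem minimalPeriod_next (d : D) : minimalPeriod M.next d = 4 := by
  rw [← M.ncard_setOf_origin_eq]
  exact M.four_valent _

theorem next_next_next_next (d : D) : M.next (M.next (M.next (M.next d))) = d := by
  have h := iterate_minimalPeriod (f := M.next) (x := d)
  rwa [minimalPeriod_next] at h

theorem next_next_ne (d : D) : M.next (M.next d) ≠ d := fun h => by
  have hdvd := IsPeriodicPt.minimalPeriod_dvd (f := M.next) (n := 2) (x := d) h
  rw [minimalPeriod_next] at hdvd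
  omega

theorem next_ne (d : D) : M.next d ≠ d := fun h => M.next_next_ne d (by rw [h, h])

theorem next_next_next (d : D) : M.next (M.next (M.next d)) = M.next.symm d := by
  rw [Equiv.eq_symm_apply, next_next_next_next]

theorem origin_eq_iff_eq_iterate_next {x d : D} : M.origin x = M.origin d ↔
    x = d ∨ x = M.next d ∨ x = M.next (M.next d) ∨ x = M.next (M.next (M.next d)) := by
  constructor
  · intro h
    obtain ⟨i, hi, rfl⟩ : ∃ i < 4, M.next^[i] d = x := by
      obtain ⟨i, hi⟩ := (M.origin_eq_iff.1 h.symm).exists_nat_pow_eq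
      rw [← Equiv.Perm.iterate_eq_pow, ← iterate_mod_minimalPeriod_eq, minimalPeriod_next] at hi
      exact ⟨i % 4, Nat.mod_lt i (by decide), hi⟩
    interval_cases i <;> simp
  · rintro (rfl | rfl | rfl | rfl) <;> simp

open Classical in
theorem sum_origin_eq [Fintype D] {β : Type*} [AddCommMonoid β] (f : D → β) (d : D) :
    ∑ x with M.origin x = M.origin d, f x =
      f d + f (M.next d) + f (M.next (M.next d)) + f (M.next (M.next (M.next d))) := by
  simp only [eq_comm (b := M.origin d), M.origin_eq_iff]
  rw [sum_sameCycle, minimalPeriod_next]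
  simp [Finset.sum_range_succ]

/-- Every vertex other than the origin of `d` is an end of none or of four edges in `S`, so by the
handshake lemma the origin of `d` has even degree in `S` too. -/
theorem mem_cornerBoundary_next_next_iff {S : Set D} {d : D} (hS : M.IsEdgeSet S)
    (hSd : ∀ x ∈ M.cornerBoundary S, M.origin x = M.origin d) :
    M.next (M.next d) ∈ M.cornerBoundary S ↔ d ∈ M.cornerBoundary S := by
  classical
  have := Fintype.ofFinite D
  have := Fintype.ofFinite M.Vertex
  set f : D → ZMod 2 := S.indicator 1 with hf
  have htotal : ∑ x, f x = 0 :=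
    Finset.sum_involution (fun x _ => M.rev x)
      (fun x _ => by simp [hf, Set.indicator_apply, hS x, CharTwo.add_self_eq_zero])
      (fun x _ _ => M.rev_ne x) (fun _ _ => Finset.mem_univ _) fun x _ => M.rev_rev x
  have hother : ∀ w ≠ M.origin d, ∑ x with M.origin x = w, f x = 0 := by
    rw [M.origin_surjective.forall]
    intro y hy
    have hnext (x : D) (hx : M.origin x = M.origin y) : f (M.next x) = f x := by
      have hmem : M.next x ∈ S ↔ x ∈ S := not_not.1 fun h => hy (hx ▸ hSd x h)
      simp [hf, Set.indicator_apply, hmem]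
    rw [sum_origin_eq, hnext (M.next (M.next y)) (by simp), hnext (M.next y) (by simp),
      hnext y rfl, CharTwo.add_self_eq_zero, zero_add, CharTwo.add_self_eq_zero]
  rw [← Finset.sum_fiberwise _ M.origin, Fintype.sum_eq_single _ hother, sum_origin_eq] at htotal
  have hopp : (M.cornerBoundary S).indicator (1 : D → ZMod 2) (M.next (M.next d)) =
      (M.cornerBoundary S).indicator 1 d := by
    rw [CellMap.indicator_cornerBoundary, CellMap.indicator_cornerBoundary, eq_comm,
      ← CharTwo.add_eq_zero, ← add_assoc]
    exact htotal
  rw [← Set.indicator_eq_one_iff_mem (ZMod 2), hopp, Set.indicator_eq_one_iff_mem]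

theorem eq_next_next_of_origin_eq_of_leftRegion_eq {x y : D} (hxy : x ≠ y)
    (horigin : M.origin x = M.origin y) (hregion : M.leftRegion x = M.leftRegion y) :
    y = M.next (M.next x) := by
  classical
  obtain ⟨S, hS, hSxy⟩ := CellMap.exists_isEdgeSet_cornerBoundary_eq (T := {x, y}) M.connected
    M.spherical (fun v => even_card_filter_pair hxy (by rw [horigin]))
    fun R => even_card_filter_pair hxy (by rw [hregion])
  have hmem (d : D) : d ∈ M.cornerBoundary S ↔ d = x ∨ d = y := by simp [hSxy]
  have hopp := (M.mem_cornerBoundary_next_next_iff (d := x) hS (by simp [hmem, horigin])).2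
    ((hmem x).2 (.inl rfl))
  exact (((hmem _).1 hopp).resolve_left (M.next_next_ne x)).symm

end PlanarDoodle

/-! ### Intersections of regions in a prime diagram -/

theorem IsKConnected.preconnected_induce_compl {V : Type*} {G : SimpleGraph V} {k : ℕ}
    (hG : IsKConnected G k) {X : Finset V} (hX : X.card < k) :
    (G.induce (X : Set V)ᶜ).Preconnected :=
  (hG.2 X hX).preconnected

theorem IsKConnected.mono {V : Type*} {G : SimpleGraph V} {k l : ℕ} (hkl : k ≤ l)
    (hG : IsKConnected G l) : IsKConnected G k :=
  ⟨hkl.trans_lt hG.1, fun X hX => hG.2 X (hX.trans_le hkl)⟩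

namespace CellMap

variable {D : Type*} {M : CellMap D}

theorem vertex_mem_closedRegion {v : M.Vertex} {R : M.Region} :
    Cell.vertex v ∈ M.closedRegion R ↔ ∃ d, M.origin d = v ∧ M.leftRegion d = R := by
  constructor
  · rintro (h | ⟨d, rfl, h | ⟨d', hd', h⟩⟩) <;> cases h
    obtain rfl | rfl := M.edgeOf_eq_iff.1 hd'.symm
    · exact ⟨_, rfl, rfl⟩
    · exact ⟨M.walk d, by simp⟩
  · rintro ⟨d, rfl, rfl⟩
    exact .inr ⟨d, rfl, .inr ⟨d, rfl, rfl⟩⟩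

theorem edge_mem_closedRegion {e : M.Edge} {R : M.Region} :
    Cell.edge e ∈ M.closedRegion R ↔ ∃ d, M.edgeOf d = e ∧ M.leftRegion d = R := by
  simp [closedRegion, closedEdge, eq_comm, and_comm]

theorem region_mem_closedRegion {R S : M.Region} :
    Cell.region S ∈ M.closedRegion R ↔ S = R := by
  simp [closedRegion, closedEdge]

theorem vertex_mem_closedEdge {v : M.Vertex} {d : D} :
    Cell.vertex v ∈ M.closedEdge (M.edgeOf d) ↔ v = M.origin d ∨ v = M.origin (M.rev d) := by
  simp [closedEdge, eq_comm (b := M.edgeOf d), M.edgeOf_eq_iff]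

theorem edge_mem_closedEdge {e e' : M.Edge} : Cell.edge e ∈ M.closedEdge e' ↔ e = e' := by
  simp [closedEdge]

theorem closedEdge_subset_closedRegion (d : D) :
    M.closedEdge (M.edgeOf d) ⊆ M.closedRegion (M.leftRegion d) :=
  fun _ hc => .inr ⟨d, rfl, hc⟩

theorem edge_mem_closedRegion_inter_iff {R S : M.Region} (hRS : R ≠ S) {e : M.Edge} :
    Cell.edge e ∈ M.closedRegion R ∩ M.closedRegion S ↔
      ∃ x, M.edgeOf x = e ∧ M.leftRegion x = R ∧ M.leftRegion (M.rev x) = S := by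
  rw [Set.mem_inter_iff, edge_mem_closedRegion, edge_mem_closedRegion]
  constructor
  · rintro ⟨⟨x, rfl, rfl⟩, y, hy, rfl⟩
    obtain rfl | rfl := M.edgeOf_eq_iff.1 hy.symm
    · exact (hRS rfl).elim
    · exact ⟨x, rfl, rfl, rfl⟩
  · rintro ⟨x, rfl, hxR, hxS⟩
    exact ⟨⟨x, rfl, hxR⟩, M.rev x, M.edgeOf_rev x, hxS⟩

theorem region_notMem_closedRegion_inter {R S T : M.Region} (hRS : R ≠ S) :
    Cell.region T ∉ M.closedRegion R ∩ M.closedRegion S := fun ⟨hR, hS⟩ =>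
  hRS ((region_mem_closedRegion.1 hR).symm.trans (region_mem_closedRegion.1 hS))

variable (M)

/-- The closures of two distinct regions are disjoint or meet in a single vertex or in a single
closed edge. -/
def RegionsMeetInCells : Prop :=
  ∀ R S : M.Region, R ≠ S →
    M.closedRegion R ∩ M.closedRegion S = ∅ ∨
    (∃ v : M.Vertex, M.closedRegion R ∩ M.closedRegion S = M.closedVertex v) ∨
    (∃ e : M.Edge, M.closedRegion R ∩ M.closedRegion S = M.closedEdge e)

/-- The boundary curve of every region passes at most once through each vertex, that is, a region
has at most one corner at each vertex. -/
def HasSimpleRegions : Prop :=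
  ∀ ⦃x y : D⦄, M.origin x = M.origin y → M.leftRegion x = M.leftRegion y → x = y

variable {M}

namespace HasSimpleRegions

variable {d x y : D}

theorem origin_rev_ne (hM : M.HasSimpleRegions) (hd : M.walk d ≠ d) :
    M.origin (M.rev d) ≠ M.origin d := fun h =>
  hd (hM (by rw [origin_walk, h]) (M.leftRegion_walk d))

theorem origin_rev_next_ne (hM : M.HasSimpleRegions) (hd : M.walk (M.walk d) ≠ d) :
    M.origin (M.rev (M.next d)) ≠ M.origin (M.rev d) := fun h => by
  have hwalk : M.walk d = M.rev (M.next d) := hM (by rw [origin_walk, h]) (by simp)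
  exact hd (by rw [hwalk, walk_rev, Equiv.symm_apply_apply])

theorem origin_ne_origin_rev (hM : M.HasSimpleRegions) (hx : M.next (M.next x) ≠ x)
    (hleft : M.leftRegion x = M.leftRegion y)
    (hright : M.leftRegion (M.rev x) = M.leftRegion (M.rev y)) :
    M.origin x ≠ M.origin (M.rev y) := fun h => by
  have hy : M.walk y = x := hM (by simp [h]) (by simp [hleft])
  have hx' : M.walk (M.rev x) = M.rev y := hM (by simp [h]) (by rw [leftRegion_walk, hright])
  rw [walk_rev, Equiv.symm_apply_eq] at hx'
  rw [← hy, next_walk, ← hx', hy] at hx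
  exact hx rfl

theorem eq_of_leftRegion_eq_of_leftRegion_rev_eq (hM : M.HasSimpleRegions)
    (hx : M.next (M.next x) ≠ x) (hleft : M.leftRegion x = M.leftRegion y)
    (hright : M.leftRegion (M.rev x) = M.leftRegion (M.rev y))
    (hxy : M.origin x = M.origin y ∨ M.origin x = M.origin (M.rev y)) : x = y :=
  hM (hxy.resolve_right (hM.origin_ne_origin_rev hx hleft hright)) hleft

theorem eq_or_eq_next_of_edge_mem_closedRegion (hM : M.HasSimpleRegions)
    (hxy : M.origin x = M.origin y)
    (hx : Cell.edge (M.edgeOf x) ∈ M.closedRegion (M.leftRegion y)) : x = y ∨ x = M.next y := by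
  obtain ⟨d, hd, hdy⟩ := edge_mem_closedRegion.1 hx
  obtain rfl | rfl := M.edgeOf_eq_iff.1 hd.symm
  · exact .inl (hM hxy hdy)
  · exact .inr ((Equiv.symm_apply_eq _).1 (hM (by simp [hxy]) (by simp [hdy])))

end HasSimpleRegions

open Classical in
theorem exists_isEdgeSet_cornerBoundary_eq_of_preconnected [Finite D] (hM : M.graph.Connected)
    (hsphere : M.eulerChar = 2) {X : Set M.Vertex} (hX : (M.graph.induce Xᶜ).Preconnected)
    {T : Finset D} (hTX : ∀ d ∈ T, M.origin d ∈ X)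
    (hvertex : ∀ v, Even {d ∈ T | M.origin d = v}.card)
    (hregion : ∀ R, Even {d ∈ T | M.leftRegion d = R}.card) :
    ∃ S, M.IsEdgeSet S ∧ M.cornerBoundary S = T ∧ ∀ d ∈ S, M.origin d ∈ X := by
  obtain ⟨S, hS, hST⟩ := exists_isEdgeSet_cornerBoundary_eq hM hsphere hvertex hregion
  obtain h | h := hS.subset_or_disjoint hX (by simpa [hST] using hTX)
  · exact ⟨S, hS, hST, h⟩
  · exact ⟨Sᶜ, hS.compl, by rw [cornerBoundary_compl, hST], h⟩

end CellMap

namespace PlanarDoodle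

open CellMap Function

variable {D : Type*} [Finite D] {M : PlanarDoodle D}

theorem IsMinimal.walk_walk_ne (hmin : M.IsMinimal) (d : D) : M.walk (M.walk d) ≠ d := by
  intro h
  have hdvd := IsPeriodicPt.minimalPeriod_dvd (f := M.walk) (n := 2) (x := d) h
  rw [← M.ncard_setOf_leftRegion_eq, Nat.dvd_prime Nat.prime_two] at hdvd
  exact hdvd.elim (hmin _).1 (hmin _).2

theorem IsMinimal.walk_ne (hmin : M.IsMinimal) (d : D) : M.walk d ≠ d := fun h =>
  hmin.walk_walk_ne d (by rw [h, h])

theorem IsMinimal.hasSimpleRegions (hmin : M.IsMinimal) (h2 : M.IsTwoConnected) :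
    M.HasSimpleRegions := by
  classical
  intro x y horigin hregion
  by_contra hxy
  have hyx := M.eq_next_next_of_origin_eq_of_leftRegion_eq hxy horigin hregion
  obtain ⟨S, hS, hSxy, hSv⟩ := exists_isEdgeSet_cornerBoundary_eq_of_preconnected (T := {x, y})
    M.connected M.spherical (h2.preconnected_induce_compl (X := {M.origin x}) (by simp))
    (by simp [horigin]) (fun v => even_card_filter_pair hxy (by rw [horigin]))
    fun R => even_card_filter_pair hxy (by rw [hregion])
  have hmem (d : D) : ¬(M.next d ∈ S ↔ d ∈ S) ↔ d = x ∨ d = y := by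
    rw [← mem_cornerBoundary, hSxy]
    simp
  have hx := (hmem x).2 (.inl rfl)
  have hy := (hmem y).2 (.inr rfl)
  have hnext := not_not.1 (mt (hmem (M.next x)).1 (by simp [hyx, M.next_ne, (M.next_ne _).symm]))
  rw [hyx] at hy
  obtain ⟨z, hzx, hz, hz₁, hz₃⟩ : ∃ z, M.origin z = M.origin x ∧ z ∉ S ∧ M.next z ∈ S ∧
      M.next (M.next (M.next z)) ∉ S := by
    by_cases hxS : x ∈ S
    · exact ⟨M.next (M.next x), by simp, by tauto, by tauto, by rw [M.next_next_next_next]; tauto⟩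
    · exact ⟨x, rfl, hxS, by tauto, by tauto⟩
  simp only [Finset.coe_singleton, Set.mem_singleton_iff] at hSv
  have hrev : M.rev (M.next z) = M.next (M.next z) := by
    have hrevS := (hS (M.next z)).2 hz₁
    obtain h | h | h | h := M.origin_eq_iff_eq_iterate_next.1 ((hSv _ hrevS).trans hzx.symm)
    · exact absurd (h ▸ hrevS) hz
    · exact absurd h (M.rev_ne _)
    · exact h
    · exact absurd (h ▸ hrevS) hz₃
  exact hmin.walk_ne (M.next z) (by rw [walk_apply, hrev, Equiv.symm_apply_apply])

theorem IsPrime.exists_isEdgeSet_cornerBoundary_eq (h3 : M.IsPrime) {d₁ d₂ d₃ d₄ : D}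
    (h₁₂ : M.origin d₁ = M.origin d₂) (h₃₄ : M.origin d₃ = M.origin d₄)
    (h₁₃ : M.leftRegion d₁ = M.leftRegion d₃) (h₂₄ : M.leftRegion d₂ = M.leftRegion d₄)
    (horigin : M.origin d₁ ≠ M.origin d₃) (hregion : M.leftRegion d₁ ≠ M.leftRegion d₂) :
    ∃ A, M.IsEdgeSet A ∧ M.cornerBoundary A = {d₁, d₂, d₃, d₄} ∧
      ∀ d ∈ A, M.origin d = M.origin d₁ ∨ M.origin d = M.origin d₃ := by
  classical
  have hdistinct : d₁ ≠ d₂ ∧ d₁ ≠ d₃ ∧ d₁ ≠ d₄ ∧ d₂ ≠ d₃ ∧ d₂ ≠ d₄ ∧ d₃ ≠ d₄ := by grind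
  obtain ⟨A, hA, hAT, hAX⟩ := exists_isEdgeSet_cornerBoundary_eq_of_preconnected
    (T := {d₁, d₂, d₃, d₄}) M.connected M.spherical
    (h3.preconnected_induce_compl (X := {M.origin d₁, M.origin d₃})
      (Finset.card_le_two.trans_lt (by decide)))
    (by simp [← h₁₂, ← h₃₄])
    (fun v => even_card_filter_insert_insert (by grind) (by grind) (by grind) (by rw [h₁₂])
      (even_card_filter_pair (by grind) (by rw [h₃₄])))
    (fun R => by
      rw [Finset.insert_comm d₂]
      exact even_card_filter_insert_insert (by grind) (by grind) (by grind) (by rw [h₁₃])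
        (even_card_filter_pair (by grind) (by rw [h₂₄])))
  exact ⟨A, hA, by simpa using hAT, by simpa using hAX⟩

theorem IsMinimal.origin_rev_eq_and_next_notMem (hmin : M.IsMinimal) (hM : M.HasSimpleRegions)
    {A : Set D} {u v : M.Vertex} (hA : M.IsEdgeSet A)
    (hAuv : ∀ d ∈ A, M.origin d = u ∨ M.origin d = v) {x : D} (hx : x ∈ A)
    (hxu : M.origin x = u) : M.origin (M.rev x) = v ∧ M.next x ∉ A := by
  have hend {y : D} (hy : y ∈ A) (hyu : M.origin y = u) : M.origin (M.rev y) = v :=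
    (hAuv _ ((hA y).2 hy)).resolve_left fun h =>
      hM.origin_rev_ne (hmin.walk_ne y) (h.trans hyu.symm)
  exact ⟨hend hx hxu, fun h => hM.origin_rev_next_ne (hmin.walk_walk_ne x)
    ((hend h (by simpa)).trans (hend hx hxu).symm)⟩

theorem IsPrime.exists_leftRegion_eq_leftRegion_rev_eq (hmin : M.IsMinimal) (h3 : M.IsPrime)
    (hM : M.HasSimpleRegions) {R S : M.Region} {u v : M.Vertex} (hRS : R ≠ S) (huv : u ≠ v)
    (hu : Cell.vertex u ∈ M.closedRegion R ∩ M.closedRegion S)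
    (hv : Cell.vertex v ∈ M.closedRegion R ∩ M.closedRegion S) :
    ∃ x, M.leftRegion x = R ∧ M.leftRegion (M.rev x) = S ∧
      s(M.origin x, M.origin (M.rev x)) = s(u, v) := by
  simp only [Set.mem_inter_iff, vertex_mem_closedRegion] at hu hv
  obtain ⟨⟨d₁, rfl, rfl⟩, d₂, hd₂u, rfl⟩ := hu
  obtain ⟨⟨d₃, rfl, hd₃R⟩, d₄, hd₄v, hd₄S⟩ := hv
  obtain ⟨A, hA, hAd, hAuv⟩ := h3.exists_isEdgeSet_cornerBoundary_eq hd₂u.symm hd₄v.symm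
    hd₃R.symm hd₄S.symm huv hRS
  have hcorner {y : D} (hyu : M.origin y = M.origin d₁) (hy : y ∈ M.cornerBoundary A) :
      y = d₁ ∨ y = d₂ := by grind
  obtain ⟨x, hxA, hxu⟩ : ∃ x ∈ A, M.origin x = M.origin d₁ := by
    have hd₁ : ¬(M.next d₁ ∈ A ↔ d₁ ∈ A) := mem_cornerBoundary.1 (by simp [hAd])
    by_cases h : d₁ ∈ A
    · exact ⟨d₁, h, rfl⟩
    · exact ⟨M.next d₁, by tauto, M.origin_next d₁⟩
  have hprev : M.next.symm x ∉ A := fun h => (hmin.origin_rev_eq_and_next_notMem hM hA hAuv h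
    (by simpa)).2 (by simpa)
  obtain ⟨hxv, hnext⟩ := hmin.origin_rev_eq_and_next_notMem hM hA hAuv hxA hxu
  have hx := hcorner hxu (by simp [mem_cornerBoundary, hxA, hnext])
  have hx' := hcorner (y := M.next.symm x) (by simpa) (by simp [mem_cornerBoundary, hxA, hprev])
  have hleft := M.leftRegion_next_symm x
  obtain rfl | rfl := hx
  · exact ⟨x, rfl, by grind, by rw [hxv]⟩
  · exact ⟨M.rev x, by grind, by rw [M.rev_rev], by rw [M.rev_rev, hxu, hxv, Sym2.eq_swap]⟩

theorem IsPrime.closedRegion_inter_eq_closedEdge (hmin : M.IsMinimal) (h3 : M.IsPrime)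
    (hM : M.HasSimpleRegions) {x : D} (hx : M.leftRegion x ≠ M.leftRegion (M.rev x)) :
    M.closedRegion (M.leftRegion x) ∩ M.closedRegion (M.leftRegion (M.rev x)) =
      M.closedEdge (M.edgeOf x) := by
  have hsub : M.closedEdge (M.edgeOf x) ⊆
      M.closedRegion (M.leftRegion x) ∩ M.closedRegion (M.leftRegion (M.rev x)) :=
    Set.subset_inter (closedEdge_subset_closedRegion x)
      (M.edgeOf_rev x ▸ closedEdge_subset_closedRegion (M.rev x))
  have hvertex (w : M.Vertex) (hw : Cell.vertex w ∈ M.closedRegion (M.leftRegion x) ∩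
      M.closedRegion (M.leftRegion (M.rev x))) : w = M.origin x ∨ w = M.origin (M.rev x) := by
    by_contra! ⟨hwx, hwx'⟩
    obtain ⟨y, hyR, hyS, hy⟩ := h3.exists_leftRegion_eq_leftRegion_rev_eq hmin hM hx hwx.symm
      (hsub (vertex_mem_closedEdge.2 (.inl rfl))) hw
    have hxy := hM.eq_of_leftRegion_eq_of_leftRegion_rev_eq (M.next_next_ne x) hyR.symm hyS.symm
      (by grind)
    grind
  refine Set.Subset.antisymm (fun c hc => ?_) hsub
  cases c with
  | vertex w => exact vertex_mem_closedEdge.2 (hvertex w hc)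
  | edge e =>
    obtain ⟨y, rfl, hyR, hyS⟩ := (edge_mem_closedRegion_inter_iff hx).1 hc
    have hy := hvertex (M.origin y) ⟨vertex_mem_closedRegion.2 ⟨y, rfl, hyR⟩,
      vertex_mem_closedRegion.2 ⟨M.next.symm y, by simp, by simpa⟩⟩
    rw [hM.eq_of_leftRegion_eq_of_leftRegion_rev_eq (M.next_next_ne y) hyR hyS hy]
    exact edge_mem_closedEdge.2 rfl
  | region T => exact (region_notMem_closedRegion_inter hx hc).elim

theorem IsPrime.regionsMeetInCells (hmin : M.IsMinimal) (h3 : M.IsPrime) :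
    M.RegionsMeetInCells := by
  have hM := hmin.hasSimpleRegions (h3.mono (by decide))
  intro R S hRS
  by_cases! hedge : ∃ x, M.leftRegion x = R ∧ M.leftRegion (M.rev x) = S
  · obtain ⟨x, rfl, rfl⟩ := hedge
    exact .inr (.inr ⟨_, h3.closedRegion_inter_eq_closedEdge hmin hM hRS⟩)
  have hvertex : ∀ c ∈ M.closedRegion R ∩ M.closedRegion S, ∃ v, c = .vertex v := by
    rintro (v | e | T) hc
    · exact ⟨v, rfl⟩
    · obtain ⟨x, -, hxR, hxS⟩ := (edge_mem_closedRegion_inter_iff hRS).1 hc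
      exact (hedge x hxR hxS).elim
    · exact (region_notMem_closedRegion_inter hRS hc).elim
  have hsub : (M.closedRegion R ∩ M.closedRegion S).Subsingleton := by
    intro c hc c' hc'
    obtain ⟨v, rfl⟩ := hvertex c hc
    obtain ⟨w, rfl⟩ := hvertex c' hc'
    by_contra hvw
    obtain ⟨x, hxR, hxS, -⟩ := h3.exists_leftRegion_eq_leftRegion_rev_eq hmin hM hRS
      (mt (congrArg Cell.vertex) hvw) hc hc'
    exact hedge x hxR hxS
  obtain h | ⟨c, h⟩ := hsub.eq_empty_or_singleton
  · exact .inl h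
  · obtain ⟨v, rfl⟩ := hvertex c (h ▸ rfl)
    exact .inr (.inl ⟨v, h⟩)

end PlanarDoodle

/-! ### Primality from intersections of regions -/

namespace CellMap

variable {D : Type*} {M : CellMap D}

namespace RegionsMeetInCells

variable {R S : M.Region}

theorem eq_of_edge_mem (hM : M.RegionsMeetInCells) (hRS : R ≠ S) {e e' : M.Edge}
    (he : Cell.edge e ∈ M.closedRegion R ∩ M.closedRegion S)
    (he' : Cell.edge e' ∈ M.closedRegion R ∩ M.closedRegion S) : e = e' := by
  obtain h | ⟨v, h⟩ | ⟨e₀, h⟩ := hM R S hRS <;> rw [h] at he he'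
  · exact he.elim
  · cases he
  · rw [edge_mem_closedEdge] at he he'
    rw [he, he']

theorem exists_dart_of_vertex_mem (hM : M.RegionsMeetInCells) (hRS : R ≠ S) {u v : M.Vertex}
    (huv : u ≠ v)
    (hu : Cell.vertex u ∈ M.closedRegion R ∩ M.closedRegion S)
    (hv : Cell.vertex v ∈ M.closedRegion R ∩ M.closedRegion S) :
    ∃ d, M.origin d = u ∧ M.origin (M.rev d) = v ∧
      Cell.edge (M.edgeOf d) ∈ M.closedRegion R ∩ M.closedRegion S := by
  obtain h | ⟨w, h⟩ | ⟨e, h⟩ := hM R S hRS <;> rw [h] at hu hv ⊢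
  · exact hu.elim
  · cases hu
    cases hv
    exact (huv rfl).elim
  · obtain ⟨d, rfl⟩ := M.edgeOf_surjective e
    rw [vertex_mem_closedEdge] at hu hv
    obtain rfl | rfl := hu <;> obtain rfl | rfl := hv
    · exact (huv rfl).elim
    · exact ⟨d, rfl, rfl, edge_mem_closedEdge.2 rfl⟩
    · exact ⟨M.rev d, rfl, by rw [M.rev_rev], edge_mem_closedEdge.2 (M.edgeOf_rev d)⟩
    · exact (huv rfl).elim

end RegionsMeetInCells

variable (M) in
/-- A set `S` of edges is a union of nontrivial bridges of the vertex set `X`, in the sense of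
Tutte: all edges that leave a union of connected components of the graph without `X`. As in
`IsEdgeSet`, the edges are encoded by their darts. -/
structure IsBridgeUnion (X : Set M.Vertex) (S : Set D) : Prop where
  isEdgeSet : M.IsEdgeSet S
  nonempty : S.Nonempty
  origin_mem : ∀ d ∈ M.cornerBoundary S, M.origin d ∈ X
  origin_rev_notMem : ∀ d ∈ S, M.origin d ∈ X → M.origin (M.rev d) ∉ X

theorem isBridgeUnion_setOf {X A : Set M.Vertex} (hA : A.Nonempty) (hAX : Disjoint A X)
    (hclosed : ∀ d, M.origin d ∈ A → M.origin (M.rev d) ∈ A ∪ X) :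
    M.IsBridgeUnion X {d | M.origin d ∈ A ∨ M.origin (M.rev d) ∈ A} where
  isEdgeSet d := by simp [M.rev_rev, or_comm]
  nonempty := by
    obtain ⟨v, hv⟩ := hA
    obtain ⟨d, rfl⟩ := M.origin_surjective v
    exact ⟨d, .inl hv⟩
  origin_mem d hd := by
    by_contra hdX
    have hmem (x : D) (hx : M.origin x ∉ X) :
        (M.origin x ∈ A ∨ M.origin (M.rev x) ∈ A) ↔ M.origin x ∈ A :=
      ⟨fun h => h.elim id fun h => (M.rev_rev x ▸ hclosed _ h).resolve_right hx, .inl⟩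
    refine hd ((hmem _ ?_).trans (.trans ?_ (hmem d hdX).symm)) <;> simp [hdX]
  origin_rev_notMem d hd hdX hdX' :=
    hd.elim (hAX.notMem_of_mem_right hdX) (hAX.notMem_of_mem_right hdX')

theorem exists_disjoint_isBridgeUnion {X : Set M.Vertex}
    (hX : ¬(M.graph.induce Xᶜ).Preconnected) :
    ∃ S S', M.IsBridgeUnion X S ∧ M.IsBridgeUnion X S' ∧ Disjoint S S' := by
  obtain ⟨a, b, hab⟩ : ∃ a b, ¬(M.graph.induce Xᶜ).Reachable a b := by
    simpa [SimpleGraph.Preconnected] using hX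
  set A : Set M.Vertex := Subtype.val '' {w | (M.graph.induce Xᶜ).Reachable a w}
  have hAX : Disjoint A X := by
    rw [Set.disjoint_left]
    rintro _ ⟨w, -, rfl⟩
    exact w.2
  have hA (d : D) (hd : M.origin d ∈ A) : M.origin (M.rev d) ∈ A ∪ X := by
    by_contra! h
    obtain ⟨hdA, hdX⟩ := not_or.1 h
    obtain ⟨w, hw, hwd⟩ := hd
    have hadj : (M.graph.induce Xᶜ).Adj w ⟨M.origin (M.rev d), hdX⟩ :=
      ⟨fun h => hdA ⟨w, hw, h⟩, d, hwd.symm, rfl⟩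
    exact hdA ⟨_, hw.trans hadj.reachable, rfl⟩
  have hA' (d : D) (hd : M.origin d ∈ (A ∪ X)ᶜ) : M.origin (M.rev d) ∈ (A ∪ X)ᶜ ∪ X := by
    by_contra! h
    obtain ⟨hdAX, hdX⟩ := not_or.1 h
    exact hd (M.rev_rev d ▸ hA _ ((not_not.1 hdAX).resolve_right hdX))
  have ha : ↑a ∈ A := ⟨a, .rfl, rfl⟩
  refine ⟨_, _, isBridgeUnion_setOf ⟨a, ha⟩ hAX hA,
    isBridgeUnion_setOf ⟨b, ?_⟩ (disjoint_compl_left.mono_right Set.subset_union_right) hA', ?_⟩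
  · rintro (⟨w, hw, hwb⟩ | hb)
    · exact hab (Subtype.ext hwb ▸ hw)
    · exact b.2 hb
  · rw [Set.disjoint_left]
    rintro d (hd | hd) (hd' | hd')
    · exact hd' (.inl hd)
    · exact hd' (hA d hd)
    · exact hd' (M.rev_rev d ▸ hA _ hd)
    · exact hd' (.inl hd)

theorem IsBridgeUnion.exists_mem_cornerBoundary_origin_ne [Finite D] {X : Set M.Vertex}
    {S : Set D} (hS : M.IsBridgeUnion X S) (hM : M.graph.Connected) (hsimple : M.HasSimpleRegions)
    {d : D} (hd : d ∉ S) :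
    ∃ y ∈ M.cornerBoundary S, ∃ t ∈ M.cornerBoundary S, M.origin t ≠ M.origin y := by
  obtain ⟨x, hx⟩ := hS.nonempty
  obtain ⟨y, hy⟩ := hS.isEdgeSet.cornerBoundary_nonempty hM hx hd
  obtain ⟨t, ht, hty, htR⟩ := hS.isEdgeSet.exists_mem_cornerBoundary_leftRegion_eq hy
  exact ⟨y, hy, t, ht, fun h => hty (hsimple h htR)⟩

end CellMap

namespace PlanarDoodle

open CellMap

variable {D : Type*} [Finite D] {M : PlanarDoodle D}

theorem IsMinimal.hasSimpleRegions_of_regionsMeetInCells (hmin : M.IsMinimal)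
    (hM : M.RegionsMeetInCells) : M.HasSimpleRegions := by
  intro d y horigin hregion
  by_contra hdy
  obtain rfl := M.eq_next_next_of_origin_eq_of_leftRegion_eq hdy horigin hregion
  set x := M.next d with hx
  by_cases hdx : M.leftRegion d = M.leftRegion x
  · exact M.next_ne x
      (M.eq_next_next_of_origin_eq_of_leftRegion_eq (M.next_ne d).symm (by simp) hdx).symm
  · have hxmem : Cell.edge (M.edgeOf x) ∈
        M.closedRegion (M.leftRegion d) ∩ M.closedRegion (M.leftRegion x) :=
      (edge_mem_closedRegion_inter_iff hdx).2 ⟨M.rev x, by simp, by simp [hx], by rw [M.rev_rev]⟩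
    have hymem : Cell.edge (M.edgeOf (M.next x)) ∈
        M.closedRegion (M.leftRegion d) ∩ M.closedRegion (M.leftRegion x) :=
      (edge_mem_closedRegion_inter_iff hdx).2 ⟨M.next x, rfl, hregion.symm, by simp⟩
    obtain h | h := M.edgeOf_eq_iff.1 (hM.eq_of_edge_mem hdx hxmem hymem)
    · exact M.next_ne x h
    · exact hmin.walk_ne x (by rw [walk_apply, ← h, Equiv.symm_apply_apply])

/-- The parity of a region forces it to be incident with `v` as well, so the regions of the two
corners share the edge from `u` to `v`, which does not belong to `S`. -/
theorem eq_next_or_eq_next_of_mem_cornerBoundary (hM : M.RegionsMeetInCells)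
    (hsimple : M.HasSimpleRegions) {u v : M.Vertex} {S : Set D} (hS : M.IsBridgeUnion {u, v} S)
    {y t : D} (hy : y ∈ M.cornerBoundary S) (ht : t ∈ M.cornerBoundary S) (hyu : M.origin y = u)
    (htu : M.origin t = u) (hyt : y ≠ t) : y = M.next t ∧ y ∉ S ∨ t = M.next y ∧ t ∉ S := by
  have hregion : M.leftRegion y ≠ M.leftRegion t := fun h => hyt (hsimple (hyu.trans htu.symm) h)
  have hcorner {z : D} (hz : z ∈ M.cornerBoundary S) (hzu : M.origin z = u) :
      u ≠ v ∧ Cell.vertex v ∈ M.closedRegion (M.leftRegion z) := by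
    obtain ⟨w, hw, hwz, hwR⟩ := hS.isEdgeSet.exists_mem_cornerBoundary_leftRegion_eq hz
    have hwu : M.origin w ≠ u := fun h => hwz (hsimple (h.trans hzu.symm) hwR)
    have hwv : M.origin w = v := (hS.origin_mem w hw).resolve_left hwu
    exact ⟨hwv ▸ hwu.symm, vertex_mem_closedRegion.2 ⟨w, hwv, hwR⟩⟩
  obtain ⟨x, hxu, hxv, hxy, hxt⟩ := hM.exists_dart_of_vertex_mem hregion (hcorner hy hyu).1
    ⟨vertex_mem_closedRegion.2 ⟨y, hyu, rfl⟩, vertex_mem_closedRegion.2 ⟨t, htu, rfl⟩⟩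
    ⟨(hcorner hy hyu).2, (hcorner ht htu).2⟩
  have hxS : x ∉ S := fun h => hS.origin_rev_notMem x h (.inl hxu) (.inr hxv)
  have hxy' := hsimple.eq_or_eq_next_of_edge_mem_closedRegion (hxu.trans hyu.symm) hxy
  have hxt' := hsimple.eq_or_eq_next_of_edge_mem_closedRegion (hxu.trans htu.symm) hxt
  have := M.next.injective.ne hyt
  grind

theorem exists_forall_mem_of_ne (hM : M.RegionsMeetInCells) (hsimple : M.HasSimpleRegions)
    {u v : M.Vertex} {S : Set D} (hS : M.IsBridgeUnion {u, v} S) {y : D}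
    (hy : y ∈ M.cornerBoundary S) (hyu : M.origin y = u) :
    ∃ ε, ∀ d, M.origin d = u → d ≠ ε → d ∈ S := by
  obtain ⟨t, ht, htu, htS, htS'⟩ : ∃ t ∈ M.cornerBoundary S, M.origin t = u ∧
      M.next t ∈ M.cornerBoundary S ∧ M.next t ∉ S := by
    obtain ⟨t, ht, hty, htu⟩ := exists_mem_cornerBoundary_origin_eq hy
    obtain ⟨rfl, h⟩ | ⟨rfl, h⟩ :=
      eq_next_or_eq_next_of_mem_cornerBoundary hM hsimple hS hy ht hyu (htu.trans hyu) hty.symm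
    · exact ⟨t, ht, htu.trans hyu, hy, h⟩
    · exact ⟨y, hy, hyu, ht, h⟩
  have h₂ : M.next (M.next t) ∈ S := by
    rw [mem_cornerBoundary] at htS
    tauto
  have h₃ : M.next (M.next (M.next t)) ∈ S := by
    by_contra h
    have hmem : M.next (M.next t) ∈ M.cornerBoundary S := by simp [mem_cornerBoundary, h, h₂]
    obtain ⟨h, -⟩ | ⟨h, -⟩ := eq_next_or_eq_next_of_mem_cornerBoundary hM hsimple hS ht hmem htu
      (by simpa) (M.next_next_ne t).symm
    · rw [M.next_next_next, Equiv.eq_symm_apply] at h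
      exact M.next_ne t h
    · exact M.next_ne _ h
  refine ⟨M.next t, fun d hd hdt => ?_⟩
  rw [mem_cornerBoundary] at ht
  obtain rfl | rfl | rfl | rfl := M.origin_eq_iff_eq_iterate_next.1 (hd.trans htu.symm)
  · tauto
  · exact (hdt rfl).elim
  · exact h₂
  · exact h₃

theorem preconnected_induce_compl_of_regionsMeetInCells (hmin : M.IsMinimal)
    (hM : M.RegionsMeetInCells) {X : Finset M.Vertex} (hX : X.card < 3) :
    (M.graph.induce (X : Set M.Vertex)ᶜ).Preconnected := by
  have hsimple := hmin.hasSimpleRegions_of_regionsMeetInCells hM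
  by_contra hpre
  obtain ⟨S, S', hS, hS', hdisj⟩ := exists_disjoint_isBridgeUnion hpre
  obtain ⟨s, hs⟩ := hS.nonempty
  obtain ⟨s', hs'⟩ := hS'.nonempty
  obtain ⟨y, hy, t, ht, hyt⟩ := hS.exists_mem_cornerBoundary_origin_ne M.connected hsimple
    (hdisj.notMem_of_mem_right hs')
  have hXyt : (X : Set M.Vertex) = {M.origin y, M.origin t} := by
    classical
    rw [← Finset.coe_pair, ← Finset.eq_of_subset_of_card_le (s := {M.origin y, M.origin t})
      (Finset.insert_subset (hS.origin_mem y hy)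
        (Finset.singleton_subset_iff.2 (hS.origin_mem t ht)))
      (by rw [Finset.card_pair hyt.symm]; omega)]
  rw [hXyt] at hS hS'
  obtain ⟨y', hy', hyy'⟩ : ∃ y' ∈ M.cornerBoundary S', M.origin y' = M.origin y := by
    obtain ⟨y', hy', t', ht', hyt'⟩ := hS'.exists_mem_cornerBoundary_origin_ne M.connected hsimple
      (hdisj.notMem_of_mem_left hs)
    obtain h | h := hS'.origin_mem y' hy'
    · exact ⟨y', hy', h⟩
    · exact ⟨t', ht', (hS'.origin_mem t' ht').resolve_right fun h' => hyt' (h'.trans h.symm)⟩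
  -- Two disjoint sets cannot both contain three of the four darts at a vertex.
  obtain ⟨ε, hε⟩ := exists_forall_mem_of_ne hM hsimple hS hy rfl
  obtain ⟨ε', hε'⟩ := exists_forall_mem_of_ne hM hsimple hS' hy' hyy'
  have hcover (d : D) (hd : M.origin d = M.origin y) : d = ε ∨ d = ε' := by
    by_contra! ⟨h, h'⟩
    exact hdisj.notMem_of_mem_left (hε d hd h) (hε' d hd h')
  have h₀ := hcover y rfl
  have h₁ := hcover (M.next y) (by simp)
  have h₂ := hcover (M.next (M.next y)) (by simp)
  have := M.next_ne y
  have := M.next_ne (M.next y)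
  have := M.next_next_ne y
  grind

theorem IsMinimal.three_le_sides (hmin : M.IsMinimal) (R : M.Region) : 3 ≤ M.sides R := by
  have hpos : M.sides R ≠ 0 := by
    obtain ⟨d, rfl⟩ := M.leftRegion_surjective R
    exact Set.ncard_ne_zero_of_mem (a := d) rfl
  have := hmin R
  omega

theorem IsMinimal.six_le_card_vertex (hmin : M.IsMinimal) : 6 ≤ Nat.card M.Vertex := by
  have := Fintype.ofFinite M.Vertex
  have := Fintype.ofFinite M.Region
  have hvertex : Nat.card M.Vertex * 4 = Nat.card D := by
    rw [← sum_ncard_fiber M.origin, Nat.card_eq_fintype_card, ← Finset.card_univ]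
    exact (Finset.sum_const_nat fun v _ => M.four_valent v).symm
  have hregion : Nat.card M.Region * 3 ≤ Nat.card D := by
    rw [← sum_ncard_fiber M.leftRegion, Nat.card_eq_fintype_card, ← Finset.card_univ,
      ← smul_eq_mul]
    exact Finset.card_nsmul_le_sum _ _ _ fun R _ => hmin.three_le_sides R
  have hedge := M.two_mul_card_edge
  have hchar := M.spherical
  rw [CellMap.eulerChar] at hchar
  omega

theorem IsMinimal.isPrime_of_regionsMeetInCells (hmin : M.IsMinimal)
    (hM : M.RegionsMeetInCells) : M.IsPrime := by
  have hcard := hmin.six_le_card_vertex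
  refine ⟨by omega, fun X hX => ?_⟩
  have := Fintype.ofFinite M.Vertex
  obtain ⟨v, -, hv⟩ := Finset.exists_mem_notMem_of_card_lt_card (s := X) (t := Finset.univ) (by
    rw [Finset.card_univ, ← Nat.card_eq_fintype_card]
    omega)
  have : Nonempty {v | v ∉ X} := ⟨v, hv⟩
  exact ⟨preconnected_induce_compl_of_regionsMeetInCells hmin hM hX⟩

end PlanarDoodle

theorem theorem4p2_general {D : Type*} [Finite D] (M : PlanarDoodle D) (hmin : M.IsMinimal) :
    M.IsPrime ↔ M.RegionsMeetInCells :=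
  ⟨PlanarDoodle.IsPrime.regionsMeetInCells hmin, hmin.isPrime_of_regionsMeetInCells⟩

theorem theorem4p2 {D : Type*} [Finite D] (M : PlanarDoodle D)
    (hmin : M.IsMinimal) (h2 : M.IsTwoConnected) :
    M.IsPrime ↔
      ∀ R S : M.Region, R ≠ S →
        M.closedRegion R ∩ M.closedRegion S = ∅ ∨
        (∃ v : M.Vertex, M.closedRegion R ∩ M.closedRegion S = M.closedVertex v) ∨
        (∃ e : M.Edge, M.closedRegion R ∩ M.closedRegion S = M.closedEdge e) :=
  theorem4p2_general M hmin
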